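/- Let $Q$ be a finite directed graph with vertex set $V(Q)$, edge set $E(Q)$ and range and source maps $r,s:E(Q)\to V(Q)$ (loops and multiple edges allowed). A contractive representation of $Q$ on a Hilbert space $H$ assigns to every vertex $v$ a self-adjoint projection $P_v\in B(H)$ (the $P_v$ are not assumed mutually orthogonal) and to every edge $e$ a contraction $T_e\in B(H)$ with $T_e=P_{r(e)}T_eP_{s(e)}$. Let $w(Q)$ be the semigroup of nonempty finite words in $V(Q)\cup E(Q)$ subject to the relations $r(x)x=x=xs(x)$ for $x\in V(Q)\cup E(Q)$, where $r(v)=s(v)=v$ for vertices $v$, and let $OA(Q)$ be the completion of the semigroup algebra $\mathbb{C}w(Q)$ in the norm $\|x\|=\sup_\pi\|\pi(x)\|$, the supremum being over all contractive representations $\pi$ of $Q$. Let $M_{OA(Q)}$ be the space of nonzero multiplicative linear functionals on $OA(Q)$ with the weak-$*$ topology, let $N_Q$ be the number of its connected components, and for $S\subseteq V(Q)$ let $n(S)=|\mathcal{E}(S)|$, where $\mathcal{E}(S)=\{e\in E(Q): r(e),s(e)\in S\}$. Then: 1. $N_Q$ is finite and $|V(Q)|=\log_2(N_Q+1)$. 2.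 If $V(Q)\neq\emptyset$, then $|E(Q)|=\max\{n(S):\emptyset\neq S\subseteq V(Q)\}$. 3. If $Q_1$ and $Q_2$ are finite directed graphs such that $OA(Q_1)$ and $OA(Q_2)$ are isomorphic as complex algebras (algebraically, with no continuity assumed), then $|V(Q_1)|=|V(Q_2)|$ and $|E(Q_1)|=|E(Q_2)|$. -/

import Mathlib

open scoped ENNReal

/-- A directed graph with vertex set `V`, edge set `E` and range and source maps `r`, `s`
(loops and multiple edges are allowed). -/
structure DirectedGraph (V : Type*) (E : Type*) where
  /-- the range map -/
  r : E → V
  /-- the source map -/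
  s : E → V

namespace DirectedGraph

variable {V E : Type*} (Q : DirectedGraph V E)

/-- The range map extended to `V ∪ E` by `r v = v`. -/
def range : V ⊕ E → V := Sum.elim id Q.r

/-- The source map extended to `V ∪ E` by `s v = v`. -/
def source : V ⊕ E → V := Sum.elim id Q.s

/-- The relations `r(x) x = x` and `x s(x) = x`, for `x ∈ V ∪ E`, on nonempty words. -/
inductive WordRel : FreeSemigroup (V ⊕ E) → FreeSemigroup (V ⊕ E) → Prop
  | range_mul (x : V ⊕ E) :
      WordRel (FreeSemigroup.of (Sum.inl (Q.range x)) * FreeSemigroup.of x) (FreeSemigroup.of x)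
  | mul_source (x : V ⊕ E) :
      WordRel (FreeSemigroup.of x * FreeSemigroup.of (Sum.inl (Q.source x))) (FreeSemigroup.of x)

/-- The semigroup `w(Q)` of nonempty finite words in `V ∪ E`, subject to the relations
`r(x) x = x = x s(x)`. -/
abbrev Words : Type _ := (conGen Q.WordRel).Quotient

/-- A contractive representation of `Q` on a Hilbert space: vertices go to (orthogonal, i.e.
self-adjoint) projections, not assumed to be mutually orthogonal, edges go to contractions, and
`T e = P (r e) T e P (s e)`. -/
structure ContractiveRep where
  /-- The Hilbert space. -/
  H : Type
  [normedAddCommGroup : NormedAddCommGroup H]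
  [innerProductSpace : InnerProductSpace ℂ H]
  [completeSpace : CompleteSpace H]
  /-- The projections assigned to the vertices. -/
  P : V → (H →L[ℂ] H)
  /-- The contractions assigned to the edges. -/
  T : E → (H →L[ℂ] H)
  isStarProjection_P : ∀ v, IsStarProjection (P v)
  norm_T_le : ∀ e, ‖T e‖ ≤ 1
  eq_T : ∀ e, T e = P (Q.r e) * T e * P (Q.s e)

attribute [instance] ContractiveRep.normedAddCommGroup ContractiveRep.innerProductSpace
  ContractiveRep.completeSpace

namespace ContractiveRep

variable {Q}
variable (π : Q.ContractiveRep)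

/-- The operator assigned to a letter. -/
def letter : V ⊕ E → (π.H →L[ℂ] π.H) := Sum.elim π.P π.T

theorem range_mul_letter (x : V ⊕ E) : π.P (Q.range x) * π.letter x = π.letter x := by
  rcases x with v | e
  · exact (π.isStarProjection_P v).isIdempotentElem
  · change π.P (Q.r e) * π.T e = π.T e
    conv_lhs => rw [π.eq_T e]
    rw [← mul_assoc, ← mul_assoc, (π.isStarProjection_P (Q.r e)).isIdempotentElem.eq,
      ← π.eq_T e]

theorem letter_mul_source (x : V ⊕ E) : π.letter x * π.P (Q.source x) = π.letter x := by
  rcases x with v | e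
  · exact (π.isStarProjection_P v).isIdempotentElem
  · change π.T e * π.P (Q.s e) = π.T e
    conv_lhs => rw [π.eq_T e]
    rw [mul_assoc, (π.isStarProjection_P (Q.s e)).isIdempotentElem.eq, ← π.eq_T e]

theorem norm_letter_le (x : V ⊕ E) : ‖π.letter x‖ ≤ 1 := by
  rcases x with v | e
  · exact (π.isStarProjection_P v).norm_le
  · exact π.norm_T_le e

theorem conGen_le : conGen Q.WordRel ≤ Con.ker (FreeSemigroup.lift π.letter) := by
  refine Con.conGen_le.2 ?_
  rintro _ _ (x | x)
  · simpa [Con.ker_rel] using! π.range_mul_letter x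
  · simpa [Con.ker_rel] using! π.letter_mul_source x

/-- The induced representation of the semigroup `w(Q)`. -/
def onWords : Q.Words →ₙ* (π.H →L[ℂ] π.H) where
  toFun w := Con.liftOn w (FreeSemigroup.lift π.letter) fun _ _ h => π.conGen_le h
  map_mul' a b := by
    induction a, b using Con.induction_on₂ with
    | _ a b => exact map_mul (FreeSemigroup.lift π.letter) a b

theorem norm_onWords_le (w : Q.Words) : ‖π.onWords w‖ ≤ 1 := by
  induction w using Con.induction_on with
  | _ a =>
    change ‖FreeSemigroup.lift π.letter a‖ ≤ 1
    induction a using FreeSemigroup.recOnMul with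
    | ih1 x => simpa using π.norm_letter_le x
    | ih2 x y hx hy =>
      rw [map_mul]
      exact (norm_mul_le _ _).trans (mul_le_one₀ hx (norm_nonneg _) hy)

/-- The induced representation of the semigroup algebra `ℂ w(Q)`. -/
noncomputable def onAlgebra : MonoidAlgebra ℂ Q.Words →ₙₐ[ℂ] (π.H →L[ℂ] π.H) :=
  MonoidAlgebra.liftMagma ℂ π.onWords

end ContractiveRep

/-- The `ℓ^∞`-direct sum of the algebras `B(H_π)` over all contractive representations `π`
of `Q`. -/
def RepSum : Type _ := lp (fun π : Q.ContractiveRep => (π.H →L[ℂ] π.H)) ∞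

namespace RepSum

noncomputable instance : NonUnitalNormedRing Q.RepSum :=
  inferInstanceAs (NonUnitalNormedRing (lp (fun π : Q.ContractiveRep => (π.H →L[ℂ] π.H)) ∞))

noncomputable instance : NormedSpace ℂ Q.RepSum :=
  inferInstanceAs (NormedSpace ℂ (lp (fun π : Q.ContractiveRep => (π.H →L[ℂ] π.H)) ∞))

instance : IsScalarTower ℂ Q.RepSum Q.RepSum :=
  inferInstanceAs (IsScalarTower ℂ (lp (fun π : Q.ContractiveRep => (π.H →L[ℂ] π.H)) ∞)
    (lp (fun π : Q.ContractiveRep => (π.H →L[ℂ] π.H)) ∞))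

instance : SMulCommClass ℂ Q.RepSum Q.RepSum :=
  inferInstanceAs (SMulCommClass ℂ (lp (fun π : Q.ContractiveRep => (π.H →L[ℂ] π.H)) ∞)
    (lp (fun π : Q.ContractiveRep => (π.H →L[ℂ] π.H)) ∞))

instance : CompleteSpace Q.RepSum :=
  inferInstanceAs (CompleteSpace (lp (fun π : Q.ContractiveRep => (π.H →L[ℂ] π.H)) ∞))

variable {Q}

/-- The projection of the direct sum onto the summand `B(H_π)`, an algebra homomorphism. -/
noncomputable def proj (π : Q.ContractiveRep) : Q.RepSum →ₙₐ[ℂ] (π.H →L[ℂ] π.H) where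
  toFun a := a.1 π
  map_smul' _ _ := rfl
  map_zero' := rfl
  map_add' _ _ := rfl
  map_mul' _ _ := rfl

theorem norm_eq (a : Q.RepSum) : ‖a‖ = ⨆ π, ‖proj π a‖ := lp.norm_eq_ciSup a

end RepSum

/-- The universal representation `w ↦ (π(w))_π` of the semigroup `w(Q)`. -/
noncomputable def universalOnWords : Q.Words →ₙ* Q.RepSum where
  toFun w := ⟨fun π => π.onWords w,
    memℓp_infty ⟨1, by rintro _ ⟨π, rfl⟩; exact π.norm_onWords_le w⟩⟩
  map_mul' a b := Subtype.ext (funext fun π => map_mul π.onWords a b)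

/-- The universal representation `x ↦ (π(x))_π` of the semigroup algebra `ℂ w(Q)`. -/
noncomputable def universalRep : MonoidAlgebra ℂ Q.Words →ₙₐ[ℂ] Q.RepSum :=
  MonoidAlgebra.liftMagma ℂ Q.universalOnWords

theorem proj_universalRep (x : MonoidAlgebra ℂ Q.Words) (π : Q.ContractiveRep) :
    RepSum.proj π (Q.universalRep x) = π.onAlgebra x := by
  suffices h : (RepSum.proj π).comp Q.universalRep = π.onAlgebra from DFunLike.congr_fun h x
  refine MonoidAlgebra.nonUnitalAlgHom_ext ℂ fun w => ?_
  have h1 : Q.universalRep (MonoidAlgebra.single w 1) = Q.universalOnWords w :=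
    DFunLike.congr_fun ((MonoidAlgebra.liftMagma ℂ).symm_apply_apply Q.universalOnWords) w
  have h2 : π.onAlgebra (MonoidAlgebra.single w 1) = π.onWords w :=
    DFunLike.congr_fun ((MonoidAlgebra.liftMagma ℂ).symm_apply_apply π.onWords) w
  rw [NonUnitalAlgHom.comp_apply, h1, h2]
  rfl

/-- The norm that `ℂ w(Q)` receives from the universal representation is the universal norm,
the supremum over all contractive representations. -/
theorem norm_universalRep (x : MonoidAlgebra ℂ Q.Words) :
    ‖Q.universalRep x‖ = ⨆ π : Q.ContractiveRep, ‖π.onAlgebra x‖ := by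
  simp only [RepSum.norm_eq, proj_universalRep]

/-- The closed subalgebra of the direct sum generated by the universal representation. -/
noncomputable def closedRange : NonUnitalSubalgebra ℂ Q.RepSum :=
  (NonUnitalAlgHom.range Q.universalRep).topologicalClosure

/-- The universal operator algebra `OA(Q)`: the completion of `ℂ w(Q)` in the universal norm
`‖x‖ = sup_π ‖π(x)‖`, realised as the closure of the image of `ℂ w(Q)` under the universal
representation, with the norm and the operations of the direct sum. (Hilbert spaces in `Type`
suffice for this supremum when `Q` is countable, since every vector lies in a separable reducing
subspace.) In general `OA(Q)` has no unit. -/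
def OA : Type _ := Q.closedRange

noncomputable instance : NonUnitalNormedRing Q.OA :=
  inferInstanceAs (NonUnitalNormedRing Q.closedRange)

noncomputable instance : Module ℂ Q.OA := inferInstanceAs (Module ℂ Q.closedRange)

noncomputable instance : NormedSpace ℂ Q.OA where
  norm_smul_le c a := norm_smul_le c (a : Q.closedRange).1

/-- The maximal ideal space `M_{OA(Q)}`: the nonzero multiplicative linear functionals on `OA(Q)`,
with the weak-* topology. -/
abbrev MaximalIdealSpace : Type _ := WeakDual.characterSpace ℂ Q.OA

/-- The number `N_Q` of connected components of `M_{OA(Q)}` (meaningful if there are finitely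
many). -/
noncomputable def numComponents : ℕ := Nat.card (ConnectedComponents Q.MaximalIdealSpace)

/-- The set `𝓔(S)` of edges with range and source in `S`. -/
def edgesIn (S : Set V) : Set E := {e | Q.r e ∈ S ∧ Q.s e ∈ S}

/-- `n(S) = |𝓔(S)|`. -/
noncomputable def n (S : Set V) : ℕ := (Q.edgesIn S).ncard

end DirectedGraph

/-- Two (not necessarily unital) complex algebras are algebraically isomorphic if there is a
bijective `ℂ`-linear multiplicative map between them; no continuity is required. -/
def AlgebraicallyIsomorphic (A B : Type*) [NonUnitalRing A] [Module ℂ A] [NonUnitalRing B]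
    [Module ℂ B] : Prop :=
  ∃ f : A →ₙₐ[ℂ] B, Function.Bijective f

/-! A character of `OA(Q)` takes the value 0 or 1 at each vertex, since vertices are idempotents.
Let `S` be the set of vertices with value 1. Each edge gets a value in the closed unit disc, and the
value is 0 unless both endpoints lie in `S`. Conversely, all such data come from one-dimensional
contractive representations. So the maximal ideal space is a disjoint union, over the nonempty `S`,
of products of closed discs indexed by `𝓔(S)`. These pieces are connected and are separated by the
values at vertices, which gives `2^|V| - 1` components (`connectedComponents_mk_eq_iff`). The
maximum of `n(S)` is attained at `S = V`.

Characters of a complete normed algebra are automatically contractive, so an algebraic isomorphism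
induces a homeomorphism of maximal ideal spaces and preserves the number of components, hence `|V|`.

Edges are counted by point derivations. At the character equal to 1 on vertices and 0 on edges,
differentiation in the disc coordinates gives a surjection `D : OA(Q₁) → ℂ^E₁`. For a surjective
homomorphism `g : OA(Q₂) → OA(Q₁)`, the map `D ∘ g` is again a point derivation. It kills the vertex
idempotents and is continuous by Cauchy's estimate, so its range is spanned by the values at the
edges of `Q₂`. Hence `|E₁| ≤ |E₂|` (`card_edges_le_of_surjective`), and an isomorphism gives both
inequalities. -/

/-- A multiplicative linear functional on a complete normed algebra is contractive; no unit and no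
continuity are assumed. -/
theorem NonUnitalAlgHom.norm_apply_le_of_complete {A : Type*} [NonUnitalNormedRing A]
    [NormedSpace ℂ A] [CompleteSpace A] (φ : A →ₙₐ[ℂ] ℂ) (a : A) : ‖φ a‖ ≤ ‖a‖ := by
  by_contra! h
  have hφ : φ a ≠ 0 := fun h0 => by
    rw [h0, norm_zero] at h
    exact (norm_nonneg a).not_gt h
  set c : A := (φ a)⁻¹ • a with hc
  have hφc : φ c = 1 := by simp [hc, map_smul, hφ]
  have hc1 : ‖c‖ < 1 := by
    rw [hc, norm_smul, norm_inv, inv_mul_lt_one₀ (norm_pos_iff.2 hφ)]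
    exact h
  -- `u n` is the power `c^(n+1)`, written as an iterate because there is no unit.
  let u : ℕ → A := fun n => (fun x => c * x)^[n] c
  have hu_succ (n : ℕ) : u (n + 1) = c * u n := Function.iterate_succ_apply' _ _ _
  have hu (n : ℕ) : ‖u n‖ ≤ ‖c‖ ^ n * ‖c‖ := by
    induction n with
    | zero => simp [u]
    | succ n ih =>
      rw [hu_succ, pow_succ', mul_assoc]
      exact (norm_mul_le _ _).trans (mul_le_mul_of_nonneg_left ih (norm_nonneg _))
  have hs : Summable u := Summable.of_norm_bounded
    ((summable_geometric_of_lt_one (norm_nonneg c) hc1).mul_right ‖c‖) hu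
  -- The sum `s` of the series satisfies `s = c + c s`; since `φ c = 1`, applying `φ` gives `φ s = 1
  -- + φ s`.
  have key : ∑' n, u n = c + c * ∑' n, u n := by
    refine hs.tsum_eq_zero_add.trans ?_
    rw [← hs.tsum_mul_left]
    simp only [hu_succ]
    rfl
  have := congrArg φ key
  rw [map_add, map_mul, hφc, one_mul] at this
  exact one_ne_zero (by linear_combination -this : (1 : ℂ) = 0)

/-! ### Generators of `OA(Q)` and induction from them -/

namespace DirectedGraph

variable {V E : Type*} {Q : DirectedGraph V E}

instance : CompleteSpace Q.OA :=
  (NonUnitalSubalgebra.isClosed_topologicalClosure _).completeSpace_coe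

namespace OA

variable (Q) in
/-- The generator of `OA(Q)` that belongs to a vertex or an edge. -/
noncomputable def gen (x : V ⊕ E) : Q.OA :=
  ⟨Q.universalRep (MonoidAlgebra.single (Con.toQuotient (FreeSemigroup.of x)) 1),
    NonUnitalSubalgebra.le_topologicalClosure _ ⟨_, rfl⟩⟩

/-- The homomorphism from `OA(Q)` to `B(H)` that a contractive representation on `H` induces. -/
noncomputable def rep (π : Q.ContractiveRep) : Q.OA →ₙₐ[ℂ] (π.H →L[ℂ] π.H) :=
  (RepSum.proj π).comp (NonUnitalSubalgebraClass.subtype Q.closedRange)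

theorem universalRep_single (w : Q.Words) :
    Q.universalRep (MonoidAlgebra.single w 1) = Q.universalOnWords w :=
  DFunLike.congr_fun ((MonoidAlgebra.liftMagma ℂ).symm_apply_apply Q.universalOnWords) w

theorem rep_gen (π : Q.ContractiveRep) (x : V ⊕ E) : rep π (gen Q x) = π.letter x := by
  change RepSum.proj π (Q.universalRep _) = _
  rw [universalRep_single]
  rfl

theorem norm_gen_le (x : V ⊕ E) : ‖gen Q x‖ ≤ 1 := by
  change ‖Q.universalRep _‖ ≤ 1
  rw [universalRep_single]
  exact lp.norm_le_of_forall_le zero_le_one fun π => π.norm_onWords_le _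

theorem gen_range_mul (x : V ⊕ E) : gen Q (.inl (Q.range x)) * gen Q x = gen Q x := by
  refine Subtype.ext ?_
  change Q.universalRep _ * Q.universalRep _ = Q.universalRep _
  rw [← map_mul, MonoidAlgebra.single_mul_single, one_mul]
  exact congrArg (fun w : Q.Words => Q.universalRep (MonoidAlgebra.single w 1))
    ((Con.eq _).2 (ConGen.Rel.of _ _ (WordRel.range_mul x)))

theorem gen_mul_source (x : V ⊕ E) : gen Q x * gen Q (.inl (Q.source x)) = gen Q x := by
  refine Subtype.ext ?_
  change Q.universalRep _ * Q.universalRep _ = Q.universalRep _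
  rw [← map_mul, MonoidAlgebra.single_mul_single, one_mul]
  exact congrArg (fun w : Q.Words => Q.universalRep (MonoidAlgebra.single w 1))
    ((Con.eq _).2 (ConGen.Rel.of _ _ (WordRel.mul_source x)))

/-- A closed property of elements of `OA(Q)` that holds for the generators and is stable under the
algebra operations holds everywhere. -/
theorem induction {p : Q.OA → Prop} (closed : IsClosed {a | p a}) (zero : p 0)
    (gen : ∀ x, p (gen Q x)) (add : ∀ a b, p a → p b → p (a + b))
    (smul : ∀ (c : ℂ) a, p a → p (c • a)) (mul : ∀ a b, p a → p b → p (a * b)) (a : Q.OA) :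
    p a := by
  let ι : MonoidAlgebra ℂ Q.Words → Q.OA := fun x =>
    ⟨Q.universalRep x, NonUnitalSubalgebra.le_topologicalClosure _ ⟨x, rfl⟩⟩
  have hword (w : Q.Words) : p (ι (MonoidAlgebra.single w 1)) := by
    induction w using Con.induction_on with
    | _ w =>
      induction w using FreeSemigroup.recOnMul with
      | ih1 x => exact gen x
      | ih2 x y hx hy =>
        have := mul _ _ hx hy
        convert this using 1
        refine Subtype.ext ?_
        change Q.universalRep _ = Q.universalRep _ * Q.universalRep _
        rw [← map_mul, MonoidAlgebra.single_mul_single, one_mul]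
        rfl
  have halg (x : MonoidAlgebra ℂ Q.Words) : p (ι x) := by
    induction x using MonoidAlgebra.induction_linear with
    | zero =>
      convert zero
      exact Subtype.ext (map_zero Q.universalRep)
    | add x y hx hy =>
      convert add _ _ hx hy
      exact Subtype.ext (map_add Q.universalRep x y)
    | single w c =>
      convert smul c _ (hword w)
      refine Subtype.ext ?_
      change Q.universalRep _ = c • Q.universalRep _
      rw [← map_smul, MonoidAlgebra.smul_single, smul_eq_mul, mul_one]
  have hdense : DenseRange (X := Q.closedRange) ι := by
    intro a
    have hι : Subtype.val '' Set.range ι = (NonUnitalAlgHom.range Q.universalRep : Set Q.RepSum) :=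
      (Set.range_comp _ _).symm
    refine closure_subtype.2 ?_
    rw [hι]
    exact a.2
  exact isClosed_property (β := Q.closedRange) hdense closed halg a

end OA

end DirectedGraph

/-! ### Characters of complete normed algebras and automatic continuity -/

open Filter Topology

namespace NonUnitalAlgHom

variable {A B : Type*} [NonUnitalNormedRing A] [NormedSpace ℂ A] [NonUnitalNormedRing B]
  [NormedSpace ℂ B]

theorem continuous_characterSpace {Z : Type*} [TopologicalSpace Z]
    {f : Z → WeakDual.characterSpace ℂ A} (h : ∀ a, Continuous fun z => f z a) : Continuous f :=
  Continuous.subtype_mk (f := fun z => (f z).1) (WeakDual.continuous_of_continuous_eval h) _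

theorem continuous_characterSpace_eval (a : A) :
    Continuous fun φ : WeakDual.characterSpace ℂ A => φ a :=
  (WeakDual.eval_continuous a).comp continuous_subtype_val

variable [CompleteSpace A]

theorem continuous_of_complete (φ : A →ₙₐ[ℂ] ℂ) : Continuous φ :=
  AddMonoidHomClass.continuous_of_bound φ 1 fun a => by
    simpa using φ.norm_apply_le_of_complete a

/-- Contractivity of every `χ z` makes the convergence uniform in `z`. This carries continuity and
holomorphy in the parameter over to limits in the algebra. -/
theorem tendstoUniformly_apply {Z : Type*} (χ : Z → A →ₙₐ[ℂ] ℂ) {x : ℕ → A} {a : A}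
    (h : Tendsto x atTop (𝓝 a)) :
    TendstoUniformly (fun n z => χ z (x n)) (fun z => χ z a) atTop := by
  rw [Metric.tendstoUniformly_iff]
  intro ε hε
  filter_upwards [Metric.tendsto_nhds.1 h ε hε] with n hn z
  rw [dist_eq_norm, ← map_sub]
  rw [dist_comm, dist_eq_norm] at hn
  exact ((χ z).norm_apply_le_of_complete _).trans_lt hn

/-- A nonzero multiplicative linear functional on a complete normed algebra, as a point of the
character space. -/
noncomputable def toCharacter (φ : A →ₙₐ[ℂ] ℂ) (h : ∃ a, φ a ≠ 0) :
    WeakDual.characterSpace ℂ A :=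
  ⟨(⟨(φ : A →ₗ[ℂ] ℂ), φ.continuous_of_complete⟩ : A →L[ℂ] ℂ),
    fun h0 => h.elim fun a ha => ha (DFunLike.congr_fun h0 a), map_mul φ⟩

/-- A surjective homomorphism of complete normed algebras, not assumed continuous, pulls
characters back to characters. -/
noncomputable def pullback (f : A →ₙₐ[ℂ] B) (hf : Function.Surjective f)
    (φ : WeakDual.characterSpace ℂ B) : WeakDual.characterSpace ℂ A :=
  toCharacter ((WeakDual.CharacterSpace.toNonUnitalAlgHom φ).comp f) <| by
    by_contra! h
    refine φ.2.1 (DFunLike.ext _ _ fun b => ?_)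
    obtain ⟨a, rfl⟩ := hf b
    exact h a

theorem continuous_pullback (f : A →ₙₐ[ℂ] B) (hf : Function.Surjective f) :
    Continuous (pullback f hf) :=
  continuous_characterSpace fun a => continuous_characterSpace_eval (f a)

variable [CompleteSpace B] in
/-- An algebraic isomorphism of complete normed algebras induces a homeomorphism of their
character spaces. -/
theorem nonempty_homeomorph_characterSpace (f : A →ₙₐ[ℂ] B) (hf : Function.Bijective f) :
    Nonempty (WeakDual.characterSpace ℂ A ≃ₜ WeakDual.characterSpace ℂ B) := by
  obtain ⟨k, hk₁, hk₂⟩ := Function.bijective_iff_has_inverse.1 hf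
  let g : B →ₙₐ[ℂ] A := f.inverse k hk₁ hk₂
  exact ⟨{
    toFun := pullback g hk₁.surjective
    invFun := pullback f hk₂.surjective
    left_inv := fun φ => WeakDual.CharacterSpace.ext fun a => congrArg φ (hk₁ a)
    right_inv := fun φ => WeakDual.CharacterSpace.ext fun b => congrArg φ (hk₂ b)
    continuous_toFun := continuous_pullback _ _
    continuous_invFun := continuous_pullback _ _ }⟩

end NonUnitalAlgHom

theorem Homeomorph.nonempty_connectedComponents_equiv {X Y : Type*} [TopologicalSpace X]
    [TopologicalSpace Y] (h : X ≃ₜ Y) :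
    Nonempty (ConnectedComponents X ≃ ConnectedComponents Y) := by
  refine ⟨⟨h.continuous.connectedComponentsMap, h.symm.continuous.connectedComponentsMap, ?_, ?_⟩⟩
  · intro x
    obtain ⟨x, rfl⟩ := ConnectedComponents.surjective_coe x
    exact congrArg _ (h.symm_apply_apply x)
  · intro x
    obtain ⟨x, rfl⟩ := ConnectedComponents.surjective_coe x
    exact congrArg _ (h.apply_symm_apply x)

/-! ### One-dimensional representations and the classification of characters -/

/-- Operators on a one-dimensional space are scalars. -/
noncomputable def ContinuousLinearMap.evalOne : (ℂ →L[ℂ] ℂ) →ₙₐ[ℂ] ℂ where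
  toFun A := A 1
  map_smul' _ _ := rfl
  map_zero' := rfl
  map_add' _ _ := rfl
  map_mul' A B := by
    have h := A.map_smul (B 1) 1
    rw [smul_eq_mul, mul_one, smul_eq_mul, mul_comm] at h
    exact h

/-- The radial retraction of the plane onto the closed unit disc. -/
noncomputable def discRetraction (ζ : ℂ) : ℂ := ζ / (max 1 ‖ζ‖ : ℝ)

theorem norm_discRetraction_le (ζ : ℂ) : ‖discRetraction ζ‖ ≤ 1 := by
  have h : (0 : ℝ) < max 1 ‖ζ‖ := lt_max_of_lt_left one_pos
  rw [discRetraction, norm_div, Complex.norm_real, Real.norm_of_nonneg h.le, div_le_one h]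
  exact le_max_right _ _

theorem discRetraction_of_norm_le {ζ : ℂ} (h : ‖ζ‖ ≤ 1) : discRetraction ζ = ζ := by
  simp [discRetraction, max_eq_left h]

theorem continuous_discRetraction : Continuous discRetraction := by
  refine continuous_id.div (by fun_prop) fun ζ => ?_
  exact_mod_cast (lt_max_of_lt_left one_pos : (0 : ℝ) < max 1 ‖ζ‖).ne'

namespace DirectedGraph

variable {V E : Type*} (Q : DirectedGraph V E)

/-- The one-dimensional representation that sends the vertices in `S` to `1`, the other vertices
to `0`, and the edges within `S` to the scalars `z e`, retracted to the unit disc. -/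
noncomputable def scalarRep (S : Set V) (z : E → ℂ) : Q.ContractiveRep where
  H := ℂ
  P v := S.indicator (fun _ => 1) v
  T e := (Q.edgesIn S).indicator (fun e => discRetraction (z e) • 1) e
  isStarProjection_P v := by
    by_cases h : v ∈ S
    · simp [h]
    · simp [h]
  norm_T_le e := by
    by_cases h : e ∈ Q.edgesIn S
    · simpa [h, norm_smul] using norm_discRetraction_le _
    · simp [h]
  eq_T e := by
    by_cases h : e ∈ Q.edgesIn S
    · simp [h, h.1, h.2]
    · simp [h]

/-- The functional on `OA(Q)` given by `scalarRep`. -/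
noncomputable def scalarHom (S : Set V) (z : E → ℂ) : Q.OA →ₙₐ[ℂ] ℂ :=
  ContinuousLinearMap.evalOne.comp (OA.rep (Q.scalarRep S z) : Q.OA →ₙₐ[ℂ] (ℂ →L[ℂ] ℂ))

variable {Q}

theorem scalarHom_gen (S : Set V) (z : E → ℂ) (x : V ⊕ E) :
    Q.scalarHom S z (OA.gen Q x) =
      ((Q.scalarRep S z).letter x : ℂ →L[ℂ] ℂ) (1 : ℂ) := by
  rw [← OA.rep_gen]
  rfl

theorem scalarHom_gen_of_mem {S : Set V} (z : E → ℂ) {v : V} (h : v ∈ S) :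
    Q.scalarHom S z (OA.gen Q (.inl v)) = 1 := by
  rw [scalarHom_gen]
  change (S.indicator (fun _ => (1 : ℂ →L[ℂ] ℂ)) v) 1 = 1
  simp [h]

theorem scalarHom_gen_of_notMem {S : Set V} (z : E → ℂ) {v : V} (h : v ∉ S) :
    Q.scalarHom S z (OA.gen Q (.inl v)) = 0 := by
  rw [scalarHom_gen]
  change (S.indicator (fun _ => (1 : ℂ →L[ℂ] ℂ)) v) 1 = 0
  simp [h]

theorem scalarHom_gen_edge (S : Set V) (z : E → ℂ) (e : E) :
    Q.scalarHom S z (OA.gen Q (.inr e)) =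
      (Q.edgesIn S).indicator (fun e => discRetraction (z e)) e := by
  rw [scalarHom_gen]
  change ((Q.edgesIn S).indicator (fun e => discRetraction (z e) • (1 : ℂ →L[ℂ] ℂ)) e) 1 = _
  by_cases h : e ∈ Q.edgesIn S <;> simp [h]

theorem continuous_scalarHom_apply (S : Set V) (a : Q.OA) :
    Continuous fun z => Q.scalarHom S z a := by
  induction a using OA.induction with
  | closed =>
    refine isClosed_of_closure_subset fun a ha => ?_
    obtain ⟨x, hx, hxa⟩ := mem_closure_iff_seq_limit.1 ha
    exact (NonUnitalAlgHom.tendstoUniformly_apply (Q.scalarHom S) hxa).continuous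
      (Frequently.of_forall hx)
  | zero => simpa only [map_zero] using continuous_const
  | gen x =>
    rcases x with v | e
    · by_cases h : v ∈ S
      · simpa only [scalarHom_gen_of_mem _ h] using continuous_const
      · simpa only [scalarHom_gen_of_notMem _ h] using continuous_const
    · simp only [scalarHom_gen_edge]
      by_cases h : e ∈ Q.edgesIn S
      · simp only [Set.indicator_of_mem h]
        exact continuous_discRetraction.comp (continuous_apply e)
      · simpa only [Set.indicator_of_notMem h] using continuous_const
  | add a b ha hb => simp only [map_add]; exact ha.add hb
  | smul c a ha => simp only [map_smul]; exact ha.const_smul c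
  | mul a b ha hb => simp only [map_mul]; exact ha.mul hb

/-- Multiplicative linear functionals on `OA(Q)` are determined by their values on generators. -/
theorem OA.hom_ext {φ ψ : Q.OA →ₙₐ[ℂ] ℂ} (h : ∀ x, φ (OA.gen Q x) = ψ (OA.gen Q x)) : φ = ψ := by
  refine DFunLike.ext _ _ fun a => ?_
  induction a using OA.induction with
  | closed => exact isClosed_eq φ.continuous_of_complete ψ.continuous_of_complete
  | zero => rw [map_zero, map_zero]
  | gen x => exact h x
  | add a b ha hb => rw [map_add, map_add, ha, hb]
  | smul c a ha => rw [map_smul, map_smul, ha]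
  | mul a b ha hb => rw [map_mul, map_mul, ha, hb]

/-- The set of vertices at which a functional on `OA(Q)` takes the value `1`. -/
def vertexSupport (φ : Q.OA →ₙₐ[ℂ] ℂ) : Set V := {v | φ (OA.gen Q (.inl v)) = 1}

theorem hom_gen_vertex (φ : Q.OA →ₙₐ[ℂ] ℂ) (v : V) :
    φ (OA.gen Q (.inl v)) = 0 ∨ φ (OA.gen Q (.inl v)) = 1 := by
  have h := congrArg φ (OA.gen_range_mul (Q := Q) (.inl v))
  rw [map_mul] at h
  exact IsIdempotentElem.iff_eq_zero_or_one.1 h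

/-- Contractivity puts the edge values in the unit disc, where the retraction is the identity. The
relations `r(e) e = e = e s(e)` force the value 0 at an edge with an endpoint outside the support.
-/
theorem eq_scalarHom (φ : Q.OA →ₙₐ[ℂ] ℂ) :
    φ = Q.scalarHom (vertexSupport φ) fun e => φ (OA.gen Q (.inr e)) := by
  refine OA.hom_ext fun x => ?_
  rcases x with v | e
  · by_cases h : v ∈ vertexSupport φ
    · rw [scalarHom_gen_of_mem _ h]
      exact h
    · rw [scalarHom_gen_of_notMem _ h]
      exact (hom_gen_vertex φ v).resolve_right h
  · rw [scalarHom_gen_edge]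
    by_cases h : e ∈ Q.edgesIn (vertexSupport φ)
    · rw [Set.indicator_of_mem h, discRetraction_of_norm_le]
      exact (φ.norm_apply_le_of_complete _).trans (OA.norm_gen_le _)
    · rw [Set.indicator_of_notMem h]
      have hr := congrArg φ (OA.gen_range_mul (Q := Q) (.inr e))
      have hs := congrArg φ (OA.gen_mul_source (Q := Q) (.inr e))
      rw [map_mul] at hr hs
      rcases not_and_or.1 h with h | h
      · rw [← hr, (hom_gen_vertex φ (Q.range (.inr e))).resolve_right h, zero_mul]
      · rw [← hs, (hom_gen_vertex φ (Q.source (.inr e))).resolve_right h, mul_zero]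

theorem vertexSupport_scalarHom (S : Set V) (z : E → ℂ) :
    vertexSupport (Q.scalarHom S z) = S := by
  ext v
  by_cases h : v ∈ S
  · simp [vertexSupport, scalarHom_gen_of_mem z h, h]
  · simp [vertexSupport, scalarHom_gen_of_notMem z h, h]

theorem vertexSupport_nonempty (φ : Q.MaximalIdealSpace) :
    (vertexSupport (WeakDual.CharacterSpace.toNonUnitalAlgHom φ)).Nonempty := by
  by_contra! h
  refine φ.2.1 (DFunLike.ext _ _ fun a => ?_)
  have h0 : WeakDual.CharacterSpace.toNonUnitalAlgHom φ = (0 : Q.OA →ₙₐ[ℂ] ℂ) := by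
    rw [eq_scalarHom (WeakDual.CharacterSpace.toNonUnitalAlgHom φ), h]
    refine OA.hom_ext fun x => ?_
    rcases x with v | e
    · exact scalarHom_gen_of_notMem _ (Set.notMem_empty v)
    · rw [scalarHom_gen_edge, Set.indicator_of_notMem fun h => h.1]
      rfl
  exact DFunLike.congr_fun h0 a

/-! ### Connected components of the maximal ideal space -/

/-- The point of the maximal ideal space given by `scalarHom`. -/
noncomputable def scalarCharacter (S : {S : Set V // S.Nonempty}) (z : E → ℂ) :
    Q.MaximalIdealSpace :=
  (Q.scalarHom S.1 z).toCharacter <| S.2.elim fun v hv =>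
    ⟨OA.gen Q (.inl v), by rw [scalarHom_gen_of_mem z hv]; exact one_ne_zero⟩

theorem connectedComponents_mk_eq_iff (φ ψ : Q.MaximalIdealSpace) :
    ConnectedComponents.mk φ = ConnectedComponents.mk ψ ↔
      vertexSupport (WeakDual.CharacterSpace.toNonUnitalAlgHom φ) =
        vertexSupport (WeakDual.CharacterSpace.toNonUnitalAlgHom ψ) := by
  rw [ConnectedComponents.coe_eq_coe]
  constructor
  · intro h
    -- Evaluation at a vertex is continuous with values in the discrete set `{0, 1}`, so it is
    -- constant on a connected component.
    have hv (v : V) : φ (OA.gen Q (.inl v)) = ψ (OA.gen Q (.inl v)) :=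
      (isPreconnected_connectedComponent (x := φ)).constant_of_mapsTo
        (T := ({0, 1} : Set ℂ)) (Set.toFinite _).isDiscrete
        (NonUnitalAlgHom.continuous_characterSpace_eval _).continuousOn
        (fun χ _ => hom_gen_vertex (WeakDual.CharacterSpace.toNonUnitalAlgHom χ) v)
        mem_connectedComponent (h ▸ mem_connectedComponent)
    ext v
    change φ _ = 1 ↔ ψ _ = 1
    rw [hv]
  · intro h
    let S : {S : Set V // S.Nonempty} := ⟨_, vertexSupport_nonempty φ⟩
    -- The characters with support `S` form the continuous image of the connected space `E → ℂ`; the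
    -- retraction to the disc allows all of it as parameter space.
    have hc : Continuous (scalarCharacter (Q := Q) S) :=
      NonUnitalAlgHom.continuous_characterSpace fun a => continuous_scalarHom_apply S.1 a
    have hpre := isPreconnected_range hc
    have hφ : φ ∈ Set.range (scalarCharacter (Q := Q) S) :=
      ⟨_, WeakDual.CharacterSpace.ext fun a => (DFunLike.congr_fun
        (eq_scalarHom (WeakDual.CharacterSpace.toNonUnitalAlgHom φ)) a).symm⟩
    have hψ : ψ ∈ Set.range (scalarCharacter (Q := Q) S) := by
      have := eq_scalarHom (WeakDual.CharacterSpace.toNonUnitalAlgHom ψ)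
      rw [← h] at this
      exact ⟨_, WeakDual.CharacterSpace.ext fun a => (DFunLike.congr_fun this a).symm⟩
    exact connectedComponent_eq (hpre.subset_connectedComponent hφ hψ)

variable (Q) in
/-- The connected components of the maximal ideal space correspond to the nonempty sets of
vertices. -/
theorem nonempty_connectedComponents_equiv :
    Nonempty (ConnectedComponents Q.MaximalIdealSpace ≃ {S : Set V // S.Nonempty}) := by
  refine ⟨Equiv.ofBijective (Quotient.lift (fun φ : Q.MaximalIdealSpace =>
    (⟨_, vertexSupport_nonempty φ⟩ : {S : Set V // S.Nonempty})) fun φ ψ h => Subtype.ext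
      ((connectedComponents_mk_eq_iff φ ψ).1 (Quotient.sound h))) ⟨?_, fun S => ?_⟩⟩
  · rintro ⟨φ⟩ ⟨ψ⟩ h
    exact (connectedComponents_mk_eq_iff φ ψ).2 (congrArg Subtype.val h)
  · exact ⟨ConnectedComponents.mk (scalarCharacter S 0),
      Subtype.ext (vertexSupport_scalarHom S.1 0)⟩

variable (Q) in
theorem finite_connectedComponents [Finite V] :
    Finite (ConnectedComponents Q.MaximalIdealSpace) :=
  let ⟨f⟩ := Q.nonempty_connectedComponents_equiv
  Finite.of_equiv _ f.symm

variable (Q) in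
theorem numComponents_add_one [Finite V] : Q.numComponents + 1 = 2 ^ Nat.card V := by
  classical
  have := Fintype.ofFinite V
  obtain ⟨f⟩ := Q.nonempty_connectedComponents_equiv
  have h1 : Nat.card {S : Set V // S.Nonempty} + 1 = Nat.card (Set V) := by
    have h : {S : Set V | S.Nonempty} = {∅}ᶜ := by
      ext S
      simp [Set.nonempty_iff_ne_empty]
    have := Set.ncard_add_ncard_compl ({∅} : Set (Set V))
    rw [Set.ncard_singleton, ← h, add_comm] at this
    exact this
  rw [numComponents, Nat.card_congr f, h1]
  simp [Nat.card_eq_fintype_card]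

variable (Q) in
theorem card_vertices_eq_logb [Finite V] :
    (Nat.card V : ℝ) = Real.logb 2 ((Q.numComponents : ℝ) + 1) := by
  have h : (Q.numComponents : ℝ) + 1 = 2 ^ Nat.card V := by exact_mod_cast Q.numComponents_add_one
  rw [h, Real.logb_pow, Real.logb_self_eq_one one_lt_two, mul_one]

variable (Q) in
theorem isGreatest_card_edges [Finite E] [Nonempty V] :
    IsGreatest {k : ℕ | ∃ S : Set V, S.Nonempty ∧ k = Q.n S} (Nat.card E) := by
  refine ⟨⟨Set.univ, Set.univ_nonempty, ?_⟩, ?_⟩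
  · simp [n, edgesIn, Set.ncard_univ]
  · rintro _ ⟨S, -, rfl⟩
    rw [n, ← Set.ncard_univ]
    exact Set.ncard_le_ncard (Set.subset_univ _)

/-! ### Analytic discs in the edge directions and their point derivations -/

open Classical in
/-- The functional that is `1` on all vertices, `ζ` on the edge `e` and `0` on the other edges. -/
noncomputable def edgeHom (e : E) (ζ : ℂ) : Q.OA →ₙₐ[ℂ] ℂ :=
  Q.scalarHom Set.univ (Pi.single e ζ)

theorem edgeHom_gen_vertex (e : E) (ζ : ℂ) (v : V) : edgeHom e ζ (OA.gen Q (.inl v)) = 1 :=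
  scalarHom_gen_of_mem _ (Set.mem_univ v)

open Classical in
theorem edgeHom_gen_edge (e e' : E) {ζ : ℂ} (h : ‖ζ‖ ≤ 1) :
    edgeHom e ζ (OA.gen Q (.inr e')) = if e' = e then ζ else 0 := by
  have hmem : e' ∈ Q.edgesIn Set.univ := ⟨Set.mem_univ _, Set.mem_univ _⟩
  rw [edgeHom, scalarHom_gen_edge, Set.indicator_of_mem hmem]
  by_cases he : e' = e
  · subst he
    simp [discRetraction_of_norm_le h]
  · simp [he, discRetraction]

/-- All the edge discs have the same centre, so the derivatives along them are point derivations at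
one common character. -/
theorem edgeHom_zero (e e' : E) : (edgeHom e 0 : Q.OA →ₙₐ[ℂ] ℂ) = edgeHom e' 0 := by
  classical
  simp [edgeHom]

theorem continuous_edgeHom_apply (e : E) (a : Q.OA) : Continuous fun ζ => edgeHom e ζ a := by
  classical
  exact (continuous_scalarHom_apply Set.univ a).comp (continuous_single (A := fun _ => ℂ) e)

/-- On generators the function is constant or equal to `ζ` inside the disc, where the retraction is
invisible. The general case follows because uniform limits of holomorphic functions are holomorphic.
-/
theorem differentiableOn_edgeHom_apply (e : E) (a : Q.OA) :
    DifferentiableOn ℂ (fun ζ => edgeHom e ζ a) (Metric.ball 0 1) := by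
  classical
  induction a using OA.induction with
  | closed =>
    refine isClosed_of_closure_subset fun a ha => ?_
    obtain ⟨x, hx, hxa⟩ := mem_closure_iff_seq_limit.1 ha
    exact ((NonUnitalAlgHom.tendstoUniformly_apply (edgeHom e) hxa).tendstoUniformlyOn
      |>.tendstoLocallyUniformlyOn).differentiableOn (Eventually.of_forall hx) Metric.isOpen_ball
  | zero => simpa only [map_zero] using differentiableOn_const 0
  | gen x =>
    rcases x with v | e'
    · simpa only [edgeHom_gen_vertex] using differentiableOn_const 1
    · have hd : DifferentiableOn ℂ (fun ζ : ℂ => if e' = e then ζ else 0) (Metric.ball 0 1) := by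
        split_ifs
        · exact differentiableOn_id
        · exact differentiableOn_const 0
      exact hd.congr fun ζ hζ => edgeHom_gen_edge e e' (mem_ball_zero_iff.1 hζ).le
  | add a b ha hb => simp only [map_add]; exact ha.add hb
  | smul c a ha => simp only [map_smul]; exact ha.const_smul c
  | mul a b ha hb => simp only [map_mul]; exact ha.mul hb

theorem differentiableAt_edgeHom_apply (e : E) (a : Q.OA) :
    DifferentiableAt ℂ (fun ζ => edgeHom e ζ a) 0 :=
  (differentiableOn_edgeHom_apply e a).differentiableAt
    (Metric.isOpen_ball.mem_nhds (Metric.mem_ball_self one_pos))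

/-- The point derivations at `edgeHom e 0` in the directions of the edges. -/
noncomputable def edgeDerivation : Q.OA →ₗ[ℂ] (E → ℂ) where
  toFun a e := deriv (fun ζ => edgeHom e ζ a) 0
  map_add' a b := by
    ext e
    simp only [map_add]
    exact deriv_fun_add (differentiableAt_edgeHom_apply e a) (differentiableAt_edgeHom_apply e b)
  map_smul' c a := by
    ext e
    simp only [map_smul]
    exact deriv_fun_const_smul c (differentiableAt_edgeHom_apply e a)

theorem edgeDerivation_apply (a : Q.OA) (e : E) :
    edgeDerivation a e = deriv (fun ζ => edgeHom e ζ a) 0 := rfl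

open Classical in
theorem edgeDerivation_gen_edge (e : E) :
    edgeDerivation (OA.gen Q (.inr e)) = Pi.single e 1 := by
  ext e'
  rw [edgeDerivation_apply]
  have h : (fun ζ => edgeHom e' ζ (OA.gen Q (.inr e))) =ᶠ[𝓝 0]
      fun ζ => if e = e' then ζ else 0 := by
    filter_upwards [Metric.ball_mem_nhds (0 : ℂ) one_pos] with ζ hζ
    exact edgeHom_gen_edge e' e (mem_ball_zero_iff.1 hζ).le
  rw [h.deriv_eq]
  by_cases he : e = e'
  · subst he
    simp
  · simp [he, Ne.symm he]

theorem surjective_edgeDerivation [Finite E] :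
    Function.Surjective (edgeDerivation : Q.OA →ₗ[ℂ] (E → ℂ)) := by
  classical
  rw [← LinearMap.range_eq_top, eq_top_iff, ← (Pi.basisFun ℂ E).span_eq, Submodule.span_le]
  rintro _ ⟨e, rfl⟩
  exact ⟨OA.gen Q (.inr e), by rw [edgeDerivation_gen_edge, Pi.basisFun_apply]⟩

theorem edgeDerivation_mul (a b : Q.OA) (e : E) :
    edgeDerivation (a * b) =
      edgeHom e 0 b • edgeDerivation a + edgeHom e 0 a • edgeDerivation b := by
  ext e'
  simp only [Pi.add_apply, Pi.smul_apply, edgeDerivation_apply, map_mul, smul_eq_mul]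
  rw [deriv_fun_mul (differentiableAt_edgeHom_apply e' a) (differentiableAt_edgeHom_apply e' b),
    edgeHom_zero e e']
  ring

/-! ### Invariance of the vertex and edge counts under isomorphism -/

variable {V₁ E₁ V₂ E₂ : Type*} {Q₁ : DirectedGraph V₁ E₁} {Q₂ : DirectedGraph V₂ E₂}

/-- The composition of `edgeDerivation` with any homomorphism is continuous, even if the
homomorphism is not: by Cauchy's estimate it inherits the contractivity of characters. -/
theorem continuous_edgeDerivation_comp [Finite E₁] (g : Q₂.OA →ₙₐ[ℂ] Q₁.OA) :
    Continuous fun b => edgeDerivation (g b) := by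
  refine continuous_pi fun e => ?_
  refine AddMonoidHomClass.continuous_of_bound
    ((LinearMap.proj e : (E₁ → ℂ) →ₗ[ℂ] ℂ) ∘ₗ edgeDerivation ∘ₗ (g : Q₂.OA →ₗ[ℂ] Q₁.OA)) 1 fun b => ?_
  change ‖deriv (fun ζ => edgeHom e ζ (g b)) 0‖ ≤ 1 * ‖b‖
  -- Cauchy's estimate on the unit circle: holomorphy inside and continuity up to the boundary
  -- suffice, and on the circle the values are bounded by `‖b‖`.
  have h := Complex.norm_deriv_le_of_forall_mem_sphere_norm_le (f := fun ζ => edgeHom e ζ (g b))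
    one_pos ⟨differentiableOn_edgeHom_apply e (g b),
      (continuous_edgeHom_apply e (g b)).continuousOn⟩
    fun ζ _ => ((edgeHom e ζ).comp g).norm_apply_le_of_complete b
  simpa using h

/-- Modulo the span `W` of its values at edge generators, the point derivation `b ↦ edgeDerivation
(g b)` vanishes on all generators, hence everywhere by the Leibniz rule and continuity. Since it is
onto `E₁ → ℂ`, that space is spanned by `|E₂|` vectors. -/
theorem card_edges_le_of_surjective [Finite E₁] [Finite E₂] (g : Q₂.OA →ₙₐ[ℂ] Q₁.OA)
    (hg : Function.Surjective g) : Nat.card E₁ ≤ Nat.card E₂ := by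
  rcases isEmpty_or_nonempty E₁ with h | ⟨⟨e₀⟩⟩
  -- The edge `e₀` serves only to name the common centre `edgeHom e₀ 0`.
  · simp
  have := Fintype.ofFinite E₁
  have := Fintype.ofFinite E₂
  let W : Submodule ℂ (E₁ → ℂ) :=
    Submodule.span ℂ (Set.range fun e => edgeDerivation (g (OA.gen Q₂ (.inr e))))
  let φ : Q₂.OA →ₙₐ[ℂ] ℂ := (edgeHom e₀ 0).comp g
  have hmul (a b : Q₂.OA) : edgeDerivation (g (a * b)) =
      φ b • edgeDerivation (g a) + φ a • edgeDerivation (g b) := by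
    rw [map_mul, edgeDerivation_mul _ _ e₀]
    rfl
  have hW (b : Q₂.OA) : edgeDerivation (g b) ∈ W := by
    induction b using OA.induction with
    | closed => exact W.closed_of_finiteDimensional.preimage (continuous_edgeDerivation_comp g)
    | zero => simp
    | gen x =>
      rcases x with v | e
      -- For an idempotent `p` the Leibniz rule reads `D p = 2 φ(p) D p`, and `φ(p)` is 0 or 1, so
      -- `D p = 0`.
      · have h := hmul (OA.gen Q₂ (.inl v)) (OA.gen Q₂ (.inl v))
        rw [show OA.gen Q₂ (.inl v) * OA.gen Q₂ (.inl v) = OA.gen Q₂ (.inl v) from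
          OA.gen_range_mul (.inl v)] at h
        have h0 : edgeDerivation (g (OA.gen Q₂ (.inl v))) = 0 := by
          rcases hom_gen_vertex φ v with hφ | hφ
          · rw [hφ] at h
            simpa using h
          · rw [hφ] at h
            simpa using h
        rw [h0]
        exact W.zero_mem
      · exact Submodule.subset_span ⟨e, rfl⟩
    | add a b ha hb =>
      rw [map_add, map_add]
      exact W.add_mem ha hb
    | smul c a ha =>
      rw [map_smul, map_smul]
      exact W.smul_mem c ha
    | mul a b ha hb =>
      rw [hmul]
      exact W.add_mem (W.smul_mem _ ha) (W.smul_mem _ hb)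
  have htop : W = ⊤ := by
    refine eq_top_iff.2 fun x _ => ?_
    obtain ⟨a, rfl⟩ := surjective_edgeDerivation (Q := Q₁) x
    obtain ⟨b, rfl⟩ := hg a
    exact hW b
  have hcard : Module.finrank ℂ W ≤ Fintype.card E₂ := finrank_range_le_card _
  rw [htop, finrank_top, Module.finrank_fintype_fun_eq_card] at hcard
  simpa only [Nat.card_eq_fintype_card] using hcard

theorem card_vertices_eq [Finite V₁] [Finite V₂] (f : Q₁.OA →ₙₐ[ℂ] Q₂.OA)
    (hf : Function.Bijective f) : Nat.card V₁ = Nat.card V₂ := by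
  obtain ⟨h⟩ := f.nonempty_homeomorph_characterSpace hf
  obtain ⟨k⟩ := h.nonempty_connectedComponents_equiv
  have hN : Q₁.numComponents = Q₂.numComponents := Nat.card_congr k
  refine Nat.pow_right_injective le_rfl ?_
  change 2 ^ Nat.card V₁ = 2 ^ Nat.card V₂
  rw [← Q₁.numComponents_add_one, ← Q₂.numComponents_add_one, hN]

theorem card_edges_eq [Finite E₁] [Finite E₂] (f : Q₁.OA →ₙₐ[ℂ] Q₂.OA)
    (hf : Function.Bijective f) : Nat.card E₁ = Nat.card E₂ := by
  obtain ⟨k, hk₁, hk₂⟩ := Function.bijective_iff_has_inverse.1 hf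
  exact le_antisymm (card_edges_le_of_surjective (f.inverse k hk₁ hk₂) hk₁.surjective)
    (card_edges_le_of_surjective f hf.2)

end DirectedGraph

theorem proposition6 :
    (∀ {V E : Type*} [Finite V] [Finite E] (Q : DirectedGraph V E),
      Finite (ConnectedComponents Q.MaximalIdealSpace) ∧
      (Nat.card V : ℝ) = Real.logb 2 ((Q.numComponents : ℝ) + 1) ∧
      (Nonempty V → IsGreatest {k : ℕ | ∃ S : Set V, S.Nonempty ∧ k = Q.n S} (Nat.card E))) ∧
    (∀ {V₁ E₁ V₂ E₂ : Type*} [Finite V₁] [Finite E₁] [Finite V₂] [Finite E₂]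
      (Q₁ : DirectedGraph V₁ E₁) (Q₂ : DirectedGraph V₂ E₂),
      AlgebraicallyIsomorphic Q₁.OA Q₂.OA →
        Nat.card V₁ = Nat.card V₂ ∧ Nat.card E₁ = Nat.card E₂) := by
  refine ⟨fun Q => ⟨Q.finite_connectedComponents, Q.card_vertices_eq_logb,
    fun _ => Q.isGreatest_card_edges⟩, ?_⟩
  rintro V₁ E₁ V₂ E₂ _ _ _ _ Q₁ Q₂ ⟨f, hf⟩
  exact ⟨DirectedGraph.card_vertices_eq f hf, DirectedGraph.card_edges_eq f hf⟩
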